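/- A real division algebra is a nonzero real vector space $A$ with a bilinear multiplication (not necessarily associative, commutative or unital) such that for every $a\in A\setminus\{0\}$ the maps $L_a\colon x\mapsto ax$ and $R_a\colon x\mapsto xa$ are bijective. The finite-dimensional real division algebras form a category whose morphisms are the nonzero linear maps $\varphi$ with $\varphi(xy)=\varphi(x)\varphi(y)$. For signs $\alpha,\beta\in\{+,-\}$ let $\mathscr{D}_2^{\alpha\beta}$ be its full subcategory of those $2$-dimensional algebras $A$ for which $\det L_a$ has sign $\alpha$ and $\det R_a$ has sign $\beta$ for all $a\in A\setminus\{0\}$. Let $\mathcal{S}$ be the set of positive definite symmetric real $2\times 2$ matrices of determinant $1$, let $K=\begin{pmatrix}1&0\\0&-1\end{pmatrix}$ and $R=\frac12\begin{pmatrix}-1&-\sqrt3\\ \sqrt3&-1\end{pmatrix}$, and put $C_2=\langle K\rangle$ and $D_3=\langle R,K\rangle$. These groups, of orders $2$ and $6$, act on $\mathcal{S}^2$ by $F\cdot(A,B)=(FAF^{t},FBF^{t})$. For a group $G$ acting on a set $M$ let ${}_GM$ be the action groupoid, with object set $M$ and with the elements $g\in G$ such that $gx=y$ as morphisms $x\to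 y$. Then: (1) the categories $\mathscr{D}_2^{++}$, $\mathscr{D}_2^{+-}$ and $\mathscr{D}_2^{-+}$ are equivalent to each other, and none of them is equivalent to $\mathscr{D}_2^{--}$; (2) each of $\mathscr{D}_2^{++}$, $\mathscr{D}_2^{+-}$, $\mathscr{D}_2^{-+}$ is equivalent to ${}_{C_2}\mathcal{S}^2$, and $\mathscr{D}_2^{--}$ is equivalent to ${}_{D_3}\mathcal{S}^2$; (3) $\mathscr{D}_2^{--}$ has an object whose automorphism group has order $6$, while every object of the other three blocks has an automorphism group of order at most $2$. -/

import Mathlib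

open CategoryTheory

universe u

/-- A finite-dimensional real division algebra: a nonzero finite-dimensional real vector space with
a bilinear multiplication (not assumed associative, commutative or unital) such that left and right
multiplication by every nonzero element are bijective. -/
structure RealDivAlg : Type (u + 1) where
  carrier : Type u
  [ring : NonUnitalNonAssocRing carrier]
  [module : Module ℝ carrier]
  [smulComm : SMulCommClass ℝ carrier carrier]
  [scalarTower : IsScalarTower ℝ carrier carrier]
  [finite : FiniteDimensional ℝ carrier]
  [nontrivial : Nontrivial carrier]
  left_bijective : ∀ a : carrier, a ≠ 0 → Function.Bijective fun x : carrier => a * x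
  right_bijective : ∀ a : carrier, a ≠ 0 → Function.Bijective fun x : carrier => x * a

namespace RealDivAlg

instance : CoeSort RealDivAlg.{u} (Type u) := ⟨RealDivAlg.carrier⟩

attribute [instance] RealDivAlg.ring RealDivAlg.module RealDivAlg.smulComm
  RealDivAlg.scalarTower RealDivAlg.finite RealDivAlg.nontrivial

/-- Morphisms: the nonzero linear maps that preserve the multiplication. -/
@[ext]
structure Hom (A B : RealDivAlg.{u}) where
  toAlgHom : A →ₙₐ[ℝ] B
  ne_zero : toAlgHom ≠ 0

theorem Hom.map_ne_zero {A B : RealDivAlg.{u}} (f : Hom A B) {x : A} (hx : x ≠ 0) :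
    f.toAlgHom x ≠ 0 := by
  intro h
  apply f.ne_zero
  ext a
  obtain ⟨y, hy⟩ := (A.left_bijective x hx).2 a
  have hy' : x * y = a := hy
  rw [← hy', map_mul, h, zero_mul]
  rfl

theorem ne_zero_of_forall {A B : RealDivAlg.{u}} (f : A →ₙₐ[ℝ] B)
    (h : ∀ x : A, x ≠ 0 → f x ≠ 0) : f ≠ 0 := by
  obtain ⟨x, hx⟩ := exists_ne (0 : A)
  intro hf
  apply h x hx
  rw [hf]
  rfl

/-- The category of finite-dimensional real division algebras. -/
instance : Category RealDivAlg.{u} where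
  Hom A B := Hom A B
  id A := ⟨NonUnitalAlgHom.id ℝ A, ne_zero_of_forall _ fun _ hx => hx⟩
  comp f g := ⟨g.toAlgHom.comp f.toAlgHom,
    ne_zero_of_forall _ fun _ hx => g.map_ne_zero (f.map_ne_zero hx)⟩

/-- The `n`-dimensional algebras with sign pair `(α, β)`: the determinant of left multiplication
by any nonzero element has sign `α`, that of right multiplication has sign `β`. -/
def HasSignPair (n : ℕ) (α β : ℤˣ) : ObjectProperty RealDivAlg.{u} := fun A =>
  Module.finrank ℝ A = n ∧
    ∀ a : A, a ≠ 0 →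
      SignType.sign (LinearMap.det (LinearMap.mulLeft ℝ a)) = SignType.sign (α : ℤ) ∧
      SignType.sign (LinearMap.det (LinearMap.mulRight ℝ a)) = SignType.sign (β : ℤ)

/-- The block of `n`-dimensional real division algebras with sign pair `(α, β)`, as a full
subcategory. -/
abbrev Block (n : ℕ) (α β : ℤˣ) : Type (u + 1) :=
  (HasSignPair.{u} n α β).FullSubcategory

end RealDivAlg

/-- Positive definite symmetric real `2 × 2` matrices of determinant one. -/
abbrev SPDS : Type :=
  {A : Matrix (Fin 2) (Fin 2) ℝ // A.PosDef ∧ A.det = 1}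

/-- Orthogonal matrices act on `SPDS` by `F • A = F A Fᵀ`. On `SPDS × SPDS` the induced action
is simultaneous conjugation. -/
noncomputable instance : MulAction (Matrix.orthogonalGroup (Fin 2) ℝ) SPDS where
  smul F A := ⟨F.1 * A.1 * F.1.transpose, by
    have hF : F.1 * F.1.transpose = 1 := (Matrix.mem_orthogonalGroup_iff (Fin 2) ℝ).1 F.2
    constructor
    · have h := A.2.1.mul_mul_conjTranspose_same (B := F.1)
        (Matrix.vecMul_injective_of_isUnit (IsUnit.of_mul_eq_one _ hF))
      rwa [Matrix.conjTranspose_eq_transpose_of_trivial] at h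
    · rw [Matrix.det_mul_right_comm, hF, one_mul, A.2.2]⟩
  one_smul A := Subtype.ext (by
    change (1 : Matrix (Fin 2) (Fin 2) ℝ) * A.1 * (1 : Matrix (Fin 2) (Fin 2) ℝ).transpose = A.1
    simp)
  mul_smul F G A := Subtype.ext (by
    change (F.1 * G.1) * A.1 * (F.1 * G.1).transpose
      = F.1 * (G.1 * A.1 * G.1.transpose) * F.1.transpose
    simp only [Matrix.transpose_mul, Matrix.mul_assoc])

/-- The matrix of complex conjugation. -/
def conjMat : Matrix.orthogonalGroup (Fin 2) ℝ :=
  ⟨!![1, 0; 0, -1], (Matrix.mem_orthogonalGroup_iff (Fin 2) ℝ).2 (by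
    ext i j; fin_cases i <;> fin_cases j <;> simp [Matrix.mul_apply])⟩

/-- The matrix of the rotation by `2π/3`. -/
noncomputable def rotMat : Matrix.orthogonalGroup (Fin 2) ℝ :=
  ⟨!![-1 / 2, -√3 / 2; √3 / 2, -1 / 2], (Matrix.mem_orthogonalGroup_iff (Fin 2) ℝ).2 (by
    have h : √3 * √3 = (3 : ℝ) := Real.mul_self_sqrt (by norm_num)
    ext i j; fin_cases i <;> fin_cases j <;> simp [Matrix.mul_apply] <;> linarith)⟩

/-- The group of order two generated by complex conjugation. -/
def groupC2 : Subgroup (Matrix.orthogonalGroup (Fin 2) ℝ) :=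
  Subgroup.closure {conjMat}

/-- The dihedral group of order six generated by the rotation by `2π/3` and conjugation. -/
noncomputable def groupD3 : Subgroup (Matrix.orthogonalGroup (Fin 2) ℝ) :=
  Subgroup.closure {rotMat, conjMat}

/-! Every two-dimensional real division algebra is an isotope of `ℂ`: its product becomes `f x * g
y` for real-linear bijections `f`, `g` of `ℂ` (`exists_isotopy`). Multiplication by a nonzero
complex number has positive determinant, so the sign pair `(α, β)` records the signs of `det g` and
`det f`.

Write `f z = p z + q z̄`, so that `det f = |p|² - |q|²`. The rescaling `z ↦ a b z` replaces `(f, g)`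
by `(a f((ab)⁻¹ z), b g((ab)⁻¹ z))`. A suitable choice of `a`, `b` makes both maps a positive
definite matrix of determinant one, followed on the right by `K` when the sign is negative
(`exists_isNormalForm_pair`). Objects thus become pairs in `𝒮²`.

A morphism between normal forms is an autotopy of `ℂ`: `φ = m n σ`, `f' φ = m σ f`, `g' φ = n σ g`,
with `σ` the identity or conjugation. Uniqueness of normal forms gives `|m| = |n| = 1`, `σ_β(mn) =
m` and `σ_α(mn) = n`, where `σ_ε` is `signConj ε` (`exists_eq_of_isotopy`). Unless both signs are
negative, this forces `m = n = 1` and leaves the group `C₂`. For two negative signs it says `m = n`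
and `m³ = 1`, which gives `D₃`. The matrix `F` of `m σ` acts on the pair by conjugation, and `φ = K
F K`; hence a fully faithful and essentially surjective functor (`blockEquivalence`).

Automorphism groups are stabilizers: at most two elements for `C₂`, and all of `D₃` at the pair `(1,
1)`. This separates the last block from the others. -/

open ComplexConjugate

/-! ### Real-linear endomorphisms of `ℂ`. -/

/-- A real `2 × 2` matrix as a real-linear endomorphism of `ℂ`, in the basis `1, i`. -/
noncomputable def realLin : Matrix (Fin 2) (Fin 2) ℝ ≃ₐ[ℝ] (ℂ →ₗ[ℝ] ℂ) :=
  Matrix.toLinAlgEquiv Complex.basisOneI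

theorem realLin_apply (M : Matrix (Fin 2) (Fin 2) ℝ) (z : ℂ) :
    realLin M z = ⟨M 0 0 * z.re + M 0 1 * z.im, M 1 0 * z.re + M 1 1 * z.im⟩ := by
  rw [realLin, Matrix.toLinAlgEquiv_apply]
  apply Complex.ext <;> simp [Matrix.mulVec, dotProduct, Fin.sum_univ_two]

theorem det_realLin (M : Matrix (Fin 2) (Fin 2) ℝ) : LinearMap.det (realLin M) = M.det :=
  LinearMap.det_toLin Complex.basisOneI M

theorem realLin_conjMat (z : ℂ) : realLin conjMat.1 z = conj z := by
  rw [realLin_apply]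
  apply Complex.ext <;> simp [conjMat]

theorem realLin_rotMat (z : ℂ) : realLin rotMat.1 z = ⟨-1 / 2, √3 / 2⟩ * z := by
  rw [realLin_apply]
  apply Complex.ext <;> simp [rotMat] <;> ring

namespace LinearMap

/-- A real-linear endomorphism of `ℂ` is a sum of a complex-linear and a semilinear map. -/
theorem exists_eq_mul_add_mul_conj (f : ℂ →ₗ[ℝ] ℂ) :
    ∃ p q : ℂ, ∀ z, f z = p * z + q * conj z := by
  -- These solve `f 1 = p + q` and `f i = i (p - q)`.
  refine ⟨(f 1 - Complex.I * f Complex.I) / 2, (f 1 + Complex.I * f Complex.I) / 2, fun z => ?_⟩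
  have hz : f z = z.re * f 1 + z.im * f Complex.I := by
    conv_lhs => rw [show z = z.re • (1 : ℂ) + z.im • Complex.I by
      simp [Complex.re_add_im]]
    rw [map_add, map_smul, map_smul, Complex.real_smul, Complex.real_smul]
  rw [hz, Complex.re_eq_add_conj, Complex.im_eq_sub_conj]
  field_simp
  linear_combination (z - conj z) * f Complex.I * Complex.I_sq

theorem det_eq_normSq_sub_normSq {f : ℂ →ₗ[ℝ] ℂ} {p q : ℂ}
    (h : ∀ z, f z = p * z + q * conj z) :
    LinearMap.det f = Complex.normSq p - Complex.normSq q := by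
  rw [← LinearMap.det_toMatrix Complex.basisOneI, Matrix.det_fin_two]
  simp [LinearMap.toMatrix_apply, h, Complex.normSq_apply]
  ring

theorem bijective_of_det_ne_zero {f : ℂ →ₗ[ℝ] ℂ} (h : LinearMap.det f ≠ 0) :
    Function.Bijective f :=
  (Module.End.isUnit_iff f).1 ((LinearMap.isUnit_iff_isUnit_det f).2 h.isUnit)

end LinearMap

/-! ### Normal forms and positive definite matrices. -/

/-- The identity of `ℂ` for the sign `1`, and complex conjugation for the sign `-1`. -/
noncomputable def signConj (ε : ℤˣ) : ℂ →+* ℂ := if ε = 1 then RingHom.id ℂ else conj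

@[simp] theorem signConj_one (z : ℂ) : signConj 1 z = z := by simp [signConj]

@[simp] theorem signConj_neg_one (z : ℂ) : signConj (-1) z = conj z := by simp [signConj]

theorem signConj_ofReal (ε : ℤˣ) (x : ℝ) : signConj ε x = x := by
  rcases Int.units_eq_one_or ε with rfl | rfl <;> simp

theorem signConj_conj (ε : ℤˣ) (z : ℂ) : signConj ε (conj z) = conj (signConj ε z) := by
  rcases Int.units_eq_one_or ε with rfl | rfl <;> simp

theorem signConj_signConj (ε : ℤˣ) (z : ℂ) : signConj ε (signConj ε z) = z := by
  rcases Int.units_eq_one_or ε with rfl | rfl <;> simp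

theorem normSq_signConj (ε : ℤˣ) (z : ℂ) :
    Complex.normSq (signConj ε z) = Complex.normSq z := by
  rcases Int.units_eq_one_or ε with rfl | rfl <;> simp

/-- The identity matrix for the sign `1`, and the matrix of complex conjugation for the
sign `-1`. -/
def signMat (ε : ℤˣ) : Matrix.orthogonalGroup (Fin 2) ℝ := if ε = 1 then 1 else conjMat

theorem realLin_signMat (ε : ℤˣ) (z : ℂ) : realLin (signMat ε).1 z = signConj ε z := by
  rcases Int.units_eq_one_or ε with rfl | rfl
  · simp [signMat]
  · simp [signMat, realLin_conjMat]

/-- The maps `z ↦ p z + q z̄` with `p > 0` and determinant one, precomposed with complex conjugation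
if the sign is negative. -/
def IsNormalForm (ε : ℤˣ) (f : ℂ → ℂ) : Prop :=
  ∃ (p : ℝ) (q : ℂ), 0 < p ∧ p ^ 2 - Complex.normSq q = 1 ∧
    ∀ z, f z = p * signConj ε z + q * conj (signConj ε z)

/-- A real matrix is symmetric exactly when its complex-linear coefficient `p` is real; then `p` is
half the trace and the determinant is `p² - |q|²`. -/
theorem isNormalForm_realLin (ε : ℤˣ) (A : SPDS) :
    IsNormalForm ε (realLin (A.1 * (signMat ε).1)) := by
  obtain ⟨A, hA, hdet⟩ := A
  have h0 : 0 < A 0 0 := hA.diag_pos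
  have h1 : 0 < A 1 1 := hA.diag_pos
  have h10 : A 1 0 = A 0 1 := by simpa using hA.isHermitian.apply 0 1
  rw [Matrix.det_fin_two, h10] at hdet
  refine ⟨(A 0 0 + A 1 1) / 2, ⟨(A 0 0 - A 1 1) / 2, A 0 1⟩, by positivity, ?_, fun z => ?_⟩
  · rw [Complex.normSq_mk]
    linear_combination hdet
  · rw [map_mul, Module.End.mul_apply, realLin_signMat, realLin_apply]
    apply Complex.ext <;> simp [h10] <;> ring

theorem IsNormalForm.exists_SPDS {ε : ℤˣ} {f : ℂ →ₗ[ℝ] ℂ} (h : IsNormalForm ε f) :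
    ∃ A : SPDS, f = realLin (A.1 * (signMat ε).1) := by
  obtain ⟨p, q, hp, hpq, hf⟩ := h
  have hpq' : p ^ 2 - (q.re * q.re + q.im * q.im) = 1 := by rwa [← Complex.normSq_apply]
  have hlt : 0 < p + q.re := by nlinarith [sq_nonneg q.im]
  refine ⟨⟨!![p + q.re, q.im; q.im, p - q.re], ?_, ?_⟩, ?_⟩
  · refine Matrix.PosDef.of_dotProduct_mulVec_pos ?_ fun x hx => ?_
    · ext i j
      fin_cases i <;> fin_cases j <;> simp
    · simp only [Matrix.mulVec, dotProduct, Fin.sum_univ_two, Pi.star_apply, star_trivial,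
        Matrix.of_apply, Matrix.cons_val_zero, Matrix.cons_val_one, Matrix.cons_val',
        Matrix.cons_val_fin_one]
      -- Completing the square: since the determinant is one, this sum equals `p + q.re` times the
      -- quadratic form at `x`.
      have key : 0 < ((p + q.re) * x 0 + q.im * x 1) ^ 2 + x 1 ^ 2 := by
        by_cases h1 : x 1 = 0
        · have h0 : x 0 ≠ 0 := fun h0 => hx (by ext i; fin_cases i <;> simp [h0, h1])
          have := mul_ne_zero hlt.ne' h0
          rw [h1, mul_zero, add_zero]
          positivity
        · positivity
      refine pos_of_mul_pos_right (a := p + q.re) ?_ hlt.le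
      have hx1 : x 1 ^ 2 * (p ^ 2 - (q.re * q.re + q.im * q.im)) = x 1 ^ 2 := by rw [hpq', mul_one]
      linarith
  · rw [Matrix.det_fin_two_of]
    linear_combination hpq'
  · ext z
    rw [hf, map_mul, Module.End.mul_apply, realLin_signMat, realLin_apply]
    apply Complex.ext <;> simp <;> ring

theorem IsNormalForm.conj_conj {ε : ℤˣ} {f : ℂ → ℂ} (h : IsNormalForm ε f) :
    IsNormalForm ε fun z => conj (f (conj z)) := by
  obtain ⟨p, q, hp, hpq, hf⟩ := h
  exact ⟨p, conj q, hp, by rwa [Complex.normSq_conj], fun z => by simp [hf, signConj_conj]⟩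

/-! ### Uniqueness of normal forms and autotopies of `ℂ`. -/

theorem coeff_unique {p q p' q' : ℂ} (h : ∀ z, p * z + q * conj z = p' * z + q' * conj z) :
    p = p' ∧ q = q' := by
  have h1 := h 1
  have hI := h Complex.I
  simp only [map_one, mul_one, Complex.conj_I] at h1 hI
  have hI' : p - q = p' - q' := by
    apply mul_right_cancel₀ Complex.I_ne_zero
    linear_combination hI
  constructor
  · linear_combination (h1 + hI') / 2
  · linear_combination (h1 - hI') / 2

/-- Compare coefficients. The difference of their squared norms is the determinant, one on both
sides, so `|n| = 1`; then the positive numbers `p` and `p'` agree and cancel, which leaves the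
equation of phases. -/
theorem IsNormalForm.eq_of_rotated {ε : ℤˣ} {f f' : ℂ → ℂ} (hf : IsNormalForm ε f)
    (hf' : IsNormalForm ε f') {m n : ℂ} (hm : m ≠ 0)
    (h : ∀ z, f' (m * n * z) = m * f z) :
    Complex.normSq n = 1 ∧ signConj ε (m * n) = m := by
  obtain ⟨p, q, hp, hpq, hf⟩ := hf
  obtain ⟨p', q', hp', hpq', hf'⟩ := hf'
  obtain ⟨h1, h2⟩ := coeff_unique (p := p' * signConj ε (m * n))
    (q := q' * conj (signConj ε (m * n))) (p' := m * p) (q' := m * q) fun z => by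
      have := h (signConj ε z)
      rw [hf, hf', map_mul, signConj_signConj, map_mul conj] at this
      linear_combination this
  have hm' : 0 < Complex.normSq m := Complex.normSq_pos.2 hm
  have n1 := congrArg Complex.normSq h1
  have n2 := congrArg Complex.normSq h2
  simp only [map_mul, Complex.normSq_conj, normSq_signConj, Complex.normSq_ofReal] at n1 n2
  have hn : Complex.normSq n = 1 := by
    apply mul_left_cancel₀ hm'.ne'
    linear_combination n1 - n2 + Complex.normSq m * hpq
      - Complex.normSq m * Complex.normSq n * hpq'
  refine ⟨hn, ?_⟩
  have hpp : p' = p := by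
    rw [hn] at n1
    have : p' * p' = p * p := by
      apply mul_left_cancel₀ hm'.ne'
      linear_combination n1
    exact (mul_self_inj hp'.le hp.le).1 this
  have hpc : (p : ℂ) ≠ 0 := by exact_mod_cast hp.ne'
  rw [hpp] at h1
  apply mul_left_cancel₀ hpc
  linear_combination h1

/-- Autotopies of the complex numbers. -/
theorem exists_eq_mul_of_autotopy {φ : ℂ →ₗ[ℝ] ℂ} {φ₁ φ₂ : ℂ → ℂ} (hφ : Function.Injective φ)
    (h : ∀ x y, φ (x * y) = φ₁ x * φ₂ y) :
    ∃ (m n : ℂ) (σ : ℤˣ), m ≠ 0 ∧ n ≠ 0 ∧ (∀ z, φ z = m * n * signConj σ z) ∧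
      (∀ z, φ₁ z = m * signConj σ z) ∧ ∀ z, φ₂ z = n * signConj σ z := by
  have hmn : φ 1 = φ₁ 1 * φ₂ 1 := by simpa using h 1 1
  have hne : φ₁ 1 * φ₂ 1 ≠ 0 := by
    rw [← hmn]
    exact (map_ne_zero_iff φ hφ).2 one_ne_zero
  obtain ⟨hm, hn⟩ := mul_ne_zero_iff.1 hne
  have hl : ∀ z, φ z = φ₁ 1 * φ₂ z := fun z => by simpa using h 1 z
  have hr : ∀ z, φ z = φ₁ z * φ₂ 1 := fun z => by simpa using h z 1
  have key : ∃ σ : ℤˣ, ∀ z, φ z = φ₁ 1 * φ₂ 1 * signConj σ z := by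
    -- Normalized to fix `1`, `φ` is multiplicative, hence a real algebra endomorphism of `ℂ`: the
    -- identity or conjugation.
    let ψ : ℂ →ₐ[ℝ] ℂ := AlgHom.ofLinearMap
      ((LinearMap.mulLeft ℝ (φ₁ 1 * φ₂ 1)⁻¹).comp φ)
      (by simp only [LinearMap.comp_apply, LinearMap.mulLeft_apply, hmn]; exact inv_mul_cancel₀ hne)
      (fun x y => by
        simp only [LinearMap.comp_apply, LinearMap.mulLeft_apply]
        rw [h x y]
        field_simp
        rw [hr x, hl y]
        ring)
    have hψ : ∀ z, φ z = φ₁ 1 * φ₂ 1 * ψ z := fun z => by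
      change _ = φ₁ 1 * φ₂ 1 * ((φ₁ 1 * φ₂ 1)⁻¹ * φ z)
      rw [mul_inv_cancel_left₀ hne]
    rcases Complex.real_algHom_eq_id_or_conj ψ with h' | h'
    · exact ⟨1, fun z => by rw [hψ, h', signConj_one]; rfl⟩
    · exact ⟨-1, fun z => by rw [hψ, h', signConj_neg_one]; rfl⟩
  obtain ⟨σ, hσ⟩ := key
  refine ⟨φ₁ 1, φ₂ 1, σ, hm, hn, hσ, fun z => ?_, fun z => ?_⟩
  · apply mul_right_cancel₀ hn
    rw [← hr, hσ]
    ring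
  · apply mul_left_cancel₀ hm
    rw [← hl, hσ]
    ring

/-- Morphisms between isotopes of `ℂ` in normal form. -/
theorem exists_eq_of_isotopy {α β : ℤˣ} {f g f' g' φ : ℂ →ₗ[ℝ] ℂ}
    (hf : IsNormalForm β f) (hg : IsNormalForm α g) (hf' : IsNormalForm β f')
    (hg' : IsNormalForm α g') (hfb : Function.Bijective f) (hgb : Function.Bijective g)
    (hφ : Function.Injective φ)
    (h : ∀ x y, φ (f x * g y) = f' (φ x) * g' (φ y)) :
    ∃ (m n : ℂ) (σ : ℤˣ), Complex.normSq m = 1 ∧ Complex.normSq n = 1 ∧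
      signConj β (m * n) = m ∧ signConj α (m * n) = n ∧ (∀ z, φ z = m * n * signConj σ z) ∧
      (∀ z, f' (φ z) = m * signConj σ (f z)) ∧ (∀ z, g' (φ z) = n * signConj σ (g z)) := by
  let ef := Equiv.ofBijective f hfb
  let eg := Equiv.ofBijective g hgb
  obtain ⟨m, n, σ, hm, hn, h0, h1, h2⟩ :=
    exists_eq_mul_of_autotopy (φ₁ := fun z => f' (φ (ef.symm z)))
      (φ₂ := fun z => g' (φ (eg.symm z))) hφ fun x y => by
        rw [← h]
        congr 2
        · exact (ef.apply_symm_apply x).symm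
        · exact (eg.apply_symm_apply y).symm
  have h1' : ∀ z, f' (φ z) = m * signConj σ (f z) := fun z => by
    rw [← h1 (f z)]
    exact congrArg (fun w => f' (φ w)) (ef.symm_apply_apply z).symm
  have h2' : ∀ z, g' (φ z) = n * signConj σ (g z) := fun z => by
    rw [← h2 (g z)]
    exact congrArg (fun w => g' (φ w)) (eg.symm_apply_apply z).symm
  -- Conjugating by `σ` preserves normal forms, so `σ` can be absorbed into `f` and `g` before
  -- comparing coefficients.
  have conjugate : ∀ {ε : ℤˣ} {k : ℂ → ℂ}, IsNormalForm ε k →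
      IsNormalForm ε fun z => signConj σ (k (signConj σ z)) := fun {ε k} hk => by
    rcases Int.units_eq_one_or σ with rfl | rfl
    · simpa using hk
    · simpa using hk.conj_conj
  obtain ⟨a1, a2⟩ := (conjugate hf).eq_of_rotated hf' hm (n := n) fun z => by
    rw [← h1', h0, signConj_signConj]
  obtain ⟨b1, b2⟩ := (conjugate hg).eq_of_rotated hg' hn (n := m) fun z => by
    rw [← h2', h0, signConj_signConj, mul_comm n m]
  exact ⟨m, n, σ, b1, a1, a2, by rwa [mul_comm n m] at b2, h0, h1', h2'⟩

/-! ### Existence of normal forms. -/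

/-- The phase equations of the normalization, with `s` and `t` the phases of the leading
coefficients of `f` and `g`. A positive sign determines one unknown at once. -/
theorem exists_unit_solution (α β : ℤˣ) {s t : ℂ} (hs : Complex.normSq s = 1)
    (ht : Complex.normSq t = 1) :
    ∃ a b : ℂ, Complex.normSq a = 1 ∧ Complex.normSq b = 1 ∧
      signConj β (a * b) = a * s ∧ signConj α (a * b) = b * t := by
  have hs' : s * conj s = 1 := by rw [Complex.mul_conj, hs, Complex.ofReal_one]
  have ht' : t * conj t = 1 := by rw [Complex.mul_conj, ht, Complex.ofReal_one]
  rcases Int.units_eq_one_or α with rfl | rfl <;> rcases Int.units_eq_one_or β with rfl | rfl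
  · exact ⟨t, s, ht, hs, by simp, by simp [mul_comm]⟩
  · refine ⟨t, conj (t * s) * conj t, ht, by simp [hs, ht], ?_, by simp only [signConj_one]; ring⟩
    simp only [signConj_neg_one, map_mul, Complex.conj_conj]
    linear_combination t * s * ht'
  · refine ⟨conj (s * t) * conj s, s, by simp [hs, ht], hs, by simp, ?_⟩
    simp only [signConj_neg_one, map_mul, Complex.conj_conj]
    linear_combination s * t * hs'
  -- For two negative signs, `a s = b t` gives `b = a s t̄`, and `conj (a b) = a s` then becomes `a³
  -- = t s̄²`.
  · obtain ⟨a, ha⟩ := IsAlgClosed.exists_pow_nat_eq (t * conj s * conj s) (n := 3) (by norm_num)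
    have ha1 : Complex.normSq a = 1 := by
      have := congrArg Complex.normSq ha
      simp only [map_pow, map_mul, Complex.normSq_conj, hs, ht, mul_one] at this
      exact (pow_eq_one_iff_of_nonneg (Complex.normSq_nonneg a) (by norm_num)).1 this
    have ha' : a * conj a = 1 := by rw [Complex.mul_conj, ha1, Complex.ofReal_one]
    have hab : conj (a * (a * s * conj t)) = a * s := by
      have e : conj a ^ 3 = conj t * s * s := by simpa using congrArg conj ha
      simp only [map_mul, Complex.conj_conj]
      linear_combination (-(conj a * (conj a * conj s * t))) * ha' +
        a * conj s * t * e + a * s * s * conj s * ht' + a * s * hs'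
    refine ⟨a, a * s * conj t, ha1, by simp [hs, ht, ha1], ?_, ?_⟩ <;> rw [signConj_neg_one, hab]
    linear_combination (-(a * s)) * ht'

theorem exists_coeff_of_sign_det {ε : ℤˣ} {f : ℂ →ₗ[ℝ] ℂ}
    (h : SignType.sign (LinearMap.det f) = SignType.sign (ε : ℤ)) :
    ∃ p q : ℂ, Complex.normSq q < Complex.normSq p ∧
      ∀ z, f z = p * signConj ε z + q * conj (signConj ε z) := by
  obtain ⟨p, q, hf⟩ := f.exists_eq_mul_add_mul_conj
  rw [LinearMap.det_eq_normSq_sub_normSq hf] at h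
  rcases Int.units_eq_one_or ε with rfl | rfl
  · refine ⟨p, q, ?_, fun z => by simp [hf]⟩
    simpa [sign_eq_one_iff] using h
  · refine ⟨q, p, ?_, fun z => by simp [hf, add_comm]⟩
    simpa [sign_eq_neg_one_iff] using h

/-- The leading coefficient of the rotated map is `a p / σ_ε(ab) = t`; its determinant, up to the
sign `ε`, is `(|p|² - |q|²) / |b|² = 1`. -/
theorem isNormalForm_rotated {ε : ℤˣ} {f : ℂ → ℂ} {p q a b : ℂ} {t : ℝ} (ht : 0 < t)
    (hf : ∀ z, f z = p * signConj ε z + q * conj (signConj ε z)) (ha : a ≠ 0)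
    (hb : Complex.normSq b = Complex.normSq p - Complex.normSq q) (hb0 : b ≠ 0)
    (h : a * p = t * signConj ε (a * b)) :
    IsNormalForm ε fun z => a * f ((a * b)⁻¹ * z) := by
  have hab : signConj ε (a * b) ≠ 0 := (map_ne_zero _).2 (mul_ne_zero ha hb0)
  have ha' : Complex.normSq a ≠ 0 := (Complex.normSq_pos.2 ha).ne'
  have hb' : Complex.normSq b ≠ 0 := (Complex.normSq_pos.2 hb0).ne'
  refine ⟨t, a * q * conj (signConj ε (a * b))⁻¹, ht, ?_, fun z => ?_⟩
  · have := congrArg Complex.normSq h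
    simp only [map_mul, Complex.normSq_conj, map_inv₀, normSq_signConj,
      Complex.normSq_ofReal] at this ⊢
    field_simp
    apply mul_left_cancel₀ ha'
    linear_combination (-1) * this - Complex.normSq a * hb
  · beta_reduce
    rw [hf, map_mul, map_inv₀, map_mul conj]
    have : a * p * (signConj ε (a * b))⁻¹ = t := by rw [h]; field_simp
    linear_combination signConj ε z * this

/-- Every pair of linear maps can be brought into normal form by an isotopy. -/
theorem exists_isNormalForm_pair {α β : ℤˣ} {f g : ℂ →ₗ[ℝ] ℂ}
    (hf : SignType.sign (LinearMap.det f) = SignType.sign (β : ℤ))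
    (hg : SignType.sign (LinearMap.det g) = SignType.sign (α : ℤ)) :
    ∃ a b : ℂ, a ≠ 0 ∧ b ≠ 0 ∧ IsNormalForm β (fun z => a * f ((a * b)⁻¹ * z)) ∧
      IsNormalForm α (fun z => b * g ((a * b)⁻¹ * z)) := by
  obtain ⟨p, q, hpq, hf⟩ := exists_coeff_of_sign_det hf
  obtain ⟨r, s, hrs, hg⟩ := exists_coeff_of_sign_det hg
  have hp : 0 < ‖p‖ := norm_pos_iff.2 (Complex.normSq_pos.1 ((Complex.normSq_nonneg q).trans_lt hpq))
  have hr : 0 < ‖r‖ := norm_pos_iff.2 (Complex.normSq_pos.1 ((Complex.normSq_nonneg s).trans_lt hrs))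
  have unit : ∀ {z : ℂ}, 0 < ‖z‖ → Complex.normSq (z / ‖z‖) = 1 := fun {z} hz => by
    rw [map_div₀, Complex.normSq_ofReal, Complex.normSq_eq_norm_sq, ← sq, div_self]
    positivity
  obtain ⟨a, b, ha, hb, hβ, hα⟩ := exists_unit_solution α β (unit hp) (unit hr)
  -- The modulus of `b` is fixed by `det f`, that of `a` by `det g`.
  obtain ⟨B, hB, hB2⟩ : ∃ B : ℝ, 0 < B ∧ B * B = Complex.normSq p - Complex.normSq q :=
    ⟨_, Real.sqrt_pos.2 (sub_pos.2 hpq), Real.mul_self_sqrt (sub_pos.2 hpq).le⟩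
  obtain ⟨A, hA, hA2⟩ : ∃ A : ℝ, 0 < A ∧ A * A = Complex.normSq r - Complex.normSq s :=
    ⟨_, Real.sqrt_pos.2 (sub_pos.2 hrs), Real.mul_self_sqrt (sub_pos.2 hrs).le⟩
  have ne : ∀ {C : ℝ} {c : ℂ}, 0 < C → Complex.normSq c = 1 → (C : ℂ) * c ≠ 0 := fun hC hc =>
    mul_ne_zero (Complex.ofReal_ne_zero.2 hC.ne') fun h => by simp [h] at hc
  have hpc : (‖p‖ : ℂ) ≠ 0 := Complex.ofReal_ne_zero.2 hp.ne'
  have hrc : (‖r‖ : ℂ) ≠ 0 := Complex.ofReal_ne_zero.2 hr.ne'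
  have hAc : (A : ℂ) ≠ 0 := Complex.ofReal_ne_zero.2 hA.ne'
  have hBc : (B : ℂ) ≠ 0 := Complex.ofReal_ne_zero.2 hB.ne'
  refine ⟨A * a, B * b, ne hA ha, ne hB hb,
    isNormalForm_rotated (t := ‖p‖ / B) (by positivity) hf (ne hA ha) ?_ (ne hB hb) ?_, ?_⟩
  · rw [map_mul, hb, Complex.normSq_ofReal, mul_one, hB2]
  · rw [mul_mul_mul_comm, map_mul, hβ, map_mul, signConj_ofReal, signConj_ofReal]
    push_cast
    field_simp
  · rw [mul_comm (A * a : ℂ)]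
    refine isNormalForm_rotated (t := ‖r‖ / A) (by positivity) hg (ne hB hb) ?_ (ne hA ha) ?_
    · rw [map_mul, ha, Complex.normSq_ofReal, mul_one, hA2]
    · rw [mul_comm (B * b : ℂ) (A * a), mul_mul_mul_comm, map_mul, hα, map_mul, signConj_ofReal,
        signConj_ofReal]
      push_cast
      field_simp

/-! ### Isotopes of `ℂ` as division algebras. -/

/-- The underlying space of the isotope of `ℂ` with multiplication `x * y = f x * g y`. -/
def IsotopeSpace (_f _g : ℂ →ₗ[ℝ] ℂ) : Type u := ULift.{u} ℂ

namespace IsotopeSpace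

variable {f g : ℂ →ₗ[ℝ] ℂ}

instance : AddCommGroup (IsotopeSpace.{u} f g) := inferInstanceAs (AddCommGroup (ULift.{u} ℂ))

noncomputable instance : Module ℝ (IsotopeSpace.{u} f g) := inferInstanceAs (Module ℝ (ULift.{u} ℂ))

variable (f g) in
/-- The identification with the complex numbers. -/
noncomputable def equivComplex : IsotopeSpace.{u} f g ≃ₗ[ℝ] ℂ := ULift.moduleEquiv

noncomputable instance : Mul (IsotopeSpace.{u} f g) where
  mul x y := (equivComplex f g).symm (f (equivComplex f g x) * g (equivComplex f g y))

theorem equivComplex_mul (x y : IsotopeSpace.{u} f g) : equivComplex f g (x * y) =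
    f (equivComplex f g x) * g (equivComplex f g y) :=
  (equivComplex f g).apply_symm_apply _

noncomputable instance : NonUnitalNonAssocRing (IsotopeSpace.{u} f g) where
  left_distrib x y z := (equivComplex f g).injective (by simp [equivComplex_mul, mul_add])
  right_distrib x y z := (equivComplex f g).injective (by simp [equivComplex_mul, add_mul])
  zero_mul x := (equivComplex f g).injective (by simp [equivComplex_mul])
  mul_zero x := (equivComplex f g).injective (by simp [equivComplex_mul])

instance : SMulCommClass ℝ (IsotopeSpace.{u} f g) (IsotopeSpace.{u} f g) where
  smul_comm r x y := (equivComplex f g).injective (by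
    simp only [smul_eq_mul]
    rw [map_smul, equivComplex_mul, equivComplex_mul, map_smul, map_smul, mul_smul_comm])

instance : IsScalarTower ℝ (IsotopeSpace.{u} f g) (IsotopeSpace.{u} f g) where
  smul_assoc r x y := (equivComplex f g).injective (by
    simp only [smul_eq_mul]
    rw [map_smul, equivComplex_mul, equivComplex_mul, map_smul, map_smul, smul_mul_assoc])

instance : FiniteDimensional ℝ (IsotopeSpace.{u} f g) :=
  (equivComplex f g).symm.finiteDimensional

instance : Nontrivial (IsotopeSpace.{u} f g) := (equivComplex f g).toEquiv.nontrivial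

end IsotopeSpace

open IsotopeSpace

namespace RealDivAlg

/-- The isotope of `ℂ` with multiplication `x * y = f x * g y`. -/
noncomputable def isotope (f g : ℂ →ₗ[ℝ] ℂ) (hf : Function.Bijective f)
    (hg : Function.Bijective g) : RealDivAlg.{u} where
  carrier := IsotopeSpace.{u} f g
  left_bijective a ha := by
    have h : f (equivComplex f g a) ≠ 0 := (map_ne_zero_iff f hf.1).2 (by simpa using ha)
    exact (equivComplex f g).symm.bijective.comp
      ((mulLeft_bijective₀ _ h).comp (hg.comp (equivComplex f g).bijective))
  right_bijective a ha := by
    have h : g (equivComplex f g a) ≠ 0 := (map_ne_zero_iff g hg.1).2 (by simpa using ha)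
    exact (equivComplex f g).symm.bijective.comp
      ((mulRight_bijective₀ _ h).comp (hf.comp (equivComplex f g).bijective))

section isotope

variable {f g f' g' : ℂ →ₗ[ℝ] ℂ} (hf : Function.Bijective f) (hg : Function.Bijective g)
  (hf' : Function.Bijective f') (hg' : Function.Bijective g')

/-- The identification of an isotope of `ℂ` with `ℂ`. -/
noncomputable def isotopeEquiv : (isotope.{u} f g hf hg) ≃ₗ[ℝ] ℂ := equivComplex f g

theorem isotopeEquiv_mul (x y : isotope.{u} f g hf hg) :
    isotopeEquiv hf hg (x * y) = f (isotopeEquiv hf hg x) * g (isotopeEquiv hf hg y) :=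
  equivComplex_mul x y

theorem det_mulLeft_complex (a : ℂ) : LinearMap.det (LinearMap.mulLeft ℝ a) = Complex.normSq a := by
  rw [LinearMap.det_eq_normSq_sub_normSq (p := a) (q := 0) (by simp)]
  simp

theorem sign_det_mul {a : ℂ} (ha : a ≠ 0) (k : ℂ →ₗ[ℝ] ℂ) :
    SignType.sign (LinearMap.det (LinearMap.mulLeft ℝ a ∘ₗ k)) =
      SignType.sign (LinearMap.det k) := by
  rw [LinearMap.det_comp, det_mulLeft_complex, sign_mul, sign_pos (Complex.normSq_pos.2 ha),
    one_mul]

/-- Left multiplication by `a` is `g` followed by multiplication by `f a`, and the latter has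
positive determinant; symmetrically on the right. -/
theorem hasSignPair_isotope {α β : ℤˣ}
    (hβ : SignType.sign (LinearMap.det f) = SignType.sign (β : ℤ))
    (hα : SignType.sign (LinearMap.det g) = SignType.sign (α : ℤ)) :
    HasSignPair.{u} 2 α β (isotope f g hf hg) := by
  let e := isotopeEquiv.{u} hf hg
  refine ⟨e.finrank_eq.trans Complex.finrank_real_complex, fun a ha => ⟨?_, ?_⟩⟩
  · have h : f (e a) ≠ 0 := (map_ne_zero_iff f hf.1).2 (by simpa using ha)
    rw [← hα, ← sign_det_mul h g, ← LinearMap.det_conj (LinearMap.mulLeft ℝ a) e]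
    refine congrArg _ (congrArg _ (LinearMap.ext fun z => ?_))
    simp [e, isotopeEquiv_mul]
  · have h : g (e a) ≠ 0 := (map_ne_zero_iff g hg.1).2 (by simpa using ha)
    rw [← hβ, ← sign_det_mul h f, ← LinearMap.det_conj (LinearMap.mulRight ℝ a) e]
    refine congrArg _ (congrArg _ (LinearMap.ext fun z => ?_))
    simp [e, isotopeEquiv_mul, mul_comm]

/-- The morphism of isotopes of `ℂ` given by a linear endomorphism of `ℂ`. -/
noncomputable def isotopeHom (φ : ℂ →ₗ[ℝ] ℂ) (hφ : Function.Injective φ)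
    (h : ∀ x y, φ (f x * g y) = f' (φ x) * g' (φ y)) :
    isotope.{u} f g hf hg ⟶ isotope.{u} f' g' hf' hg' where
  toAlgHom :=
    { (isotopeEquiv.{u} hf' hg').symm.toLinearMap ∘ₗ φ ∘ₗ (isotopeEquiv.{u} hf hg).toLinearMap with
      map_zero' := LinearMap.map_zero _
      map_mul' := fun x y => (isotopeEquiv.{u} hf' hg').injective (by
        change isotopeEquiv.{u} hf' hg' ((isotopeEquiv.{u} hf' hg').symm (φ (isotopeEquiv.{u} hf hg (x * y)))) =
          isotopeEquiv.{u} hf' hg' ((isotopeEquiv.{u} hf' hg').symm (φ (isotopeEquiv.{u} hf hg x)) *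
            (isotopeEquiv.{u} hf' hg').symm (φ (isotopeEquiv.{u} hf hg y)))
        simp [isotopeEquiv_mul, h]) }
  ne_zero := ne_zero_of_forall _ fun x hx => by
    change (isotopeEquiv.{u} hf' hg').symm (φ (isotopeEquiv.{u} hf hg x)) ≠ 0
    simpa [map_eq_zero_iff φ hφ] using hx

theorem isotopeHom_apply (φ : ℂ →ₗ[ℝ] ℂ) (hφ : Function.Injective φ)
    (h : ∀ x y, φ (f x * g y) = f' (φ x) * g' (φ y)) (x : isotope.{u} f g hf hg) :
    (isotopeHom hf hg hf' hg' φ hφ h).toAlgHom x =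
      (isotopeEquiv hf' hg').symm (φ (isotopeEquiv hf hg x)) := rfl

/-- Every morphism of isotopes of `ℂ` is given by a linear endomorphism of `ℂ`. -/
theorem exists_eq_isotopeHom (k : isotope.{u} f g hf hg ⟶ isotope.{u} f' g' hf' hg') :
    ∃ φ hφ h, k = isotopeHom hf hg hf' hg' φ hφ h := by
  let φ : ℂ →ₗ[ℝ] ℂ := (isotopeEquiv hf' hg').toLinearMap ∘ₗ (k.toAlgHom : _ →ₗ[ℝ] _) ∘ₗ
    (isotopeEquiv hf hg).symm.toLinearMap
  have hφ' : ∀ z, φ z = isotopeEquiv hf' hg' (k.toAlgHom ((isotopeEquiv hf hg).symm z)) :=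
    fun z => rfl
  refine ⟨φ, ?_, fun x y => ?_, ?_⟩
  · refine (injective_iff_map_eq_zero φ).2 fun z hz => ?_
    by_contra hne
    refine k.map_ne_zero (x := (isotopeEquiv hf hg).symm z) (by simpa using hne) ?_
    rw [hφ'] at hz
    simpa using hz
  · have hmul : (isotopeEquiv hf hg).symm (f x * g y) =
        (isotopeEquiv hf hg).symm x * (isotopeEquiv hf hg).symm y :=
      (isotopeEquiv hf hg).injective (by simp [isotopeEquiv_mul])
    rw [hφ', hφ', hφ', hmul, map_mul, isotopeEquiv_mul]
  · apply Hom.ext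
    ext x
    rw [isotopeHom_apply, hφ']
    simp

end isotope

/-! ### Two-dimensional division algebras as isotopes of `ℂ`. -/

/-- An isomorphism of real division algebras from a multiplicative linear equivalence. -/
noncomputable def isoOfLinearEquiv {A B : RealDivAlg.{u}} (e : A ≃ₗ[ℝ] B)
    (h : ∀ x y, e (x * y) = e x * e y) : A ≅ B where
  hom := ⟨{ (e : A →ₗ[ℝ] B) with map_zero' := map_zero e, map_mul' := h },
    ne_zero_of_forall _ fun _ hx => (map_ne_zero_iff e e.injective).2 hx⟩
  inv := ⟨{ (e.symm : B →ₗ[ℝ] A) with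
      map_zero' := map_zero e.symm
      map_mul' := fun x y => e.injective (by
        change e (e.symm (x * y)) = e (e.symm x * e.symm y)
        simp [h]) },
    ne_zero_of_forall _ fun _ hx => (map_ne_zero_iff e.symm e.symm.injective).2 hx⟩
  hom_inv_id := Hom.ext (by ext x; exact e.symm_apply_apply x)
  inv_hom_id := Hom.ext (by ext x; exact e.apply_symm_apply x)

/-- A two-dimensional space with a bilinear product having a unit and no zero divisors is
isomorphic to `ℂ`. -/
theorem exists_complex_equiv {V : Type*} [AddCommGroup V] [Module ℝ V]
    (hV : Module.finrank ℝ V = 2) (m : V →ₗ[ℝ] V →ₗ[ℝ] V) (e : V)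
    (hl : ∀ x, m e x = x) (hr : ∀ x, m x e = x) (hm : ∀ x y, m x y = 0 → x = 0 ∨ y = 0) :
    ∃ h : ℂ ≃ₗ[ℝ] V, ∀ z w, h (z * w) = m (h z) (h w) := by
  have : FiniteDimensional ℝ V := .of_finrank_pos (by omega)
  have he : e ≠ 0 := by
    rintro rfl
    have : Subsingleton V := ⟨fun x y => by rw [← hl x, ← hl y]; simp⟩
    simp [Module.finrank_zero_of_subsingleton] at hV
  obtain ⟨v, hv⟩ : ∃ v, v ∉ Submodule.span ℝ {e} := by
    by_contra! hall
    have := finrank_le_one e fun w => Submodule.mem_span_singleton.1 (hall w)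
    omega
  have basis : ∀ w, w ∉ Submodule.span ℝ {e} → ∀ x, ∃ a b : ℝ, x = a • e + b • w := by
    intro w hw x
    have hli : LinearIndependent ℝ ![e, w] := by
      rw [LinearIndependent.pair_iff' he]
      exact fun a ha => hw (Submodule.mem_span_singleton.2 ⟨a, ha⟩)
    have htop := hli.span_eq_top_of_card_eq_finrank (by simp [hV])
    have hx : x ∈ Submodule.span ℝ (Set.range ![e, w]) := htop ▸ Submodule.mem_top
    rw [Matrix.range_cons, Matrix.range_cons, Matrix.range_empty, Set.union_empty,
      Set.singleton_union, Submodule.mem_span_pair] at hx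
    obtain ⟨a, b, h⟩ := hx
    exact ⟨a, b, h.symm⟩
  obtain ⟨a, b, hab⟩ := basis v hv (m v v)
  -- complete the square
  let w := v - (b / 2) • e
  have hw : w ∉ Submodule.span ℝ {e} := fun h => hv (by
    have := add_mem h (Submodule.smul_mem _ (b / 2) (Submodule.mem_span_singleton_self e))
    simpa [w] using this)
  have hww : m w w = (a + b ^ 2 / 4) • e := by
    simp only [w, map_sub, map_smul, LinearMap.sub_apply, LinearMap.smul_apply, hl, hr, hab]
    module
  -- Otherwise `w² = s² e` factors as `(w - s e)(w + s e) = 0`, and `w` would be a multiple of `e`.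
  have hneg : a + b ^ 2 / 4 < 0 := by
    by_contra! hge
    let s := √(a + b ^ 2 / 4)
    have hs : s * s = a + b ^ 2 / 4 := Real.mul_self_sqrt hge
    have hprod : m (w - s • e) (w + s • e) = 0 := by
      simp only [map_sub, map_add, map_smul, LinearMap.sub_apply, LinearMap.smul_apply, hl, hr,
        hww, ← hs]
      module
    rcases hm _ _ hprod with h | h
    · exact hw (Submodule.mem_span_singleton.2 ⟨s, (sub_eq_zero.1 h).symm⟩)
    · exact hw (Submodule.mem_span_singleton.2
        ⟨-s, by rw [neg_smul, eq_neg_of_add_eq_zero_left h]⟩)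
  let t := √(-(a + b ^ 2 / 4))
  have ht : t * t = -(a + b ^ 2 / 4) := Real.mul_self_sqrt (by linarith)
  have ht0 : t ≠ 0 := (Real.sqrt_pos.2 (by linarith)).ne'
  let i := t⁻¹ • w
  have hi : i ∉ Submodule.span ℝ {e} := fun h => hw (by
    have := Submodule.smul_mem _ t h
    rwa [smul_inv_smul₀ ht0] at this)
  have hii : m i i = -e := by
    simp only [i, map_smul, LinearMap.smul_apply, hww, smul_smul]
    rw [← neg_one_smul ℝ e]
    congr 1
    field_simp
    linarith
  let h₀ : ℂ →ₗ[ℝ] V :=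
    Complex.reLm.smulRight e + Complex.imLm.smulRight i
  have hh : ∀ z, h₀ z = z.re • e + z.im • i := fun z => rfl
  have hsurj : Function.Surjective h₀ := fun x => by
    obtain ⟨c, d, hx⟩ := basis i hi x
    exact ⟨⟨c, d⟩, by rw [hh, hx]⟩
  have hinj : Function.Injective h₀ :=
    (LinearMap.injective_iff_surjective_of_finrank_eq_finrank
      (by rw [hV, Complex.finrank_real_complex])).2 hsurj
  refine ⟨LinearEquiv.ofBijective h₀ ⟨hinj, hsurj⟩, fun z w => ?_⟩
  change h₀ (z * w) = m (h₀ z) (h₀ w)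
  simp only [hh, map_add, map_smul, LinearMap.add_apply,
    LinearMap.smul_apply, hl, hr, hii, Complex.mul_re, Complex.mul_im]
  module

/-- Every two-dimensional real division algebra is an isotope of `ℂ`. -/
theorem exists_isotopy (A : RealDivAlg.{u}) (hA : Module.finrank ℝ A = 2) :
    ∃ (u : A) (h : ℂ ≃ₗ[ℝ] A), u ≠ 0 ∧ ∀ z w, h z * h w =
      h (h.symm (h z * u) * h.symm (u * h w)) := by
  obtain ⟨u, hu⟩ := exists_ne (0 : A)
  let R : A ≃ₗ[ℝ] A := LinearEquiv.ofBijective (LinearMap.mulRight ℝ u) (A.right_bijective u hu)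
  let L : A ≃ₗ[ℝ] A := LinearEquiv.ofBijective (LinearMap.mulLeft ℝ u) (A.left_bijective u hu)
  have hR : ∀ x, R x = x * u := fun x => rfl
  have hL : ∀ x, L x = u * x := fun x => rfl
  -- Kaplansky's trick: the product `R_u⁻¹ x · L_u⁻¹ y` has the unit `u u` and still no zero
  -- divisors.
  let m : A →ₗ[ℝ] A →ₗ[ℝ] A :=
    (LinearMap.mul ℝ A).compl₁₂ (R.symm : A →ₗ[ℝ] A) (L.symm : A →ₗ[ℝ] A)
  have hm : ∀ x y, m x y = R.symm x * L.symm y := fun x y => rfl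
  obtain ⟨h, hh⟩ := exists_complex_equiv hA m (u * u)
    (fun x => by
      rw [hm, ← hR u, R.symm_apply_apply, ← hL, L.apply_symm_apply])
    (fun x => by
      rw [hm, ← hL u, L.symm_apply_apply, ← hR, R.apply_symm_apply])
    (fun x y hxy => by
      rw [hm] at hxy
      by_cases hx : x = 0
      · exact Or.inl hx
      · refine Or.inr ?_
        have hx' : R.symm x ≠ 0 := by simpa using hx
        have : L.symm y = 0 := (A.left_bijective _ hx').1 (by simpa using hxy)
        simpa using this)
  refine ⟨u, h, hu, fun z w => ?_⟩
  rw [hh, h.apply_symm_apply, h.apply_symm_apply, hm, ← hR, ← hL, R.symm_apply_apply,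
    L.symm_apply_apply]

end RealDivAlg

/-! ### The groups `C₂` and `D₃`. -/

theorem conjMat_mul_self : conjMat * conjMat = 1 := by
  ext i j
  fin_cases i <;> fin_cases j <;> simp [conjMat]

theorem rotMat_pow_three : rotMat ^ 3 = 1 := by
  have h : √3 * √3 = (3 : ℝ) := Real.mul_self_sqrt (by norm_num)
  apply Subtype.ext
  change rotMat.1 ^ 3 = 1
  rw [pow_three]
  ext i j
  fin_cases i <;> fin_cases j <;> simp [rotMat, Matrix.mul_apply] <;>
    first
    | linear_combination (3 / 8) * h
    | linear_combination (√3 / 8) * h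
    | linear_combination (-√3 / 8) * h

theorem conjMat_mul_rotMat : conjMat * rotMat * conjMat = rotMat ^ 2 := by
  have h : √3 * √3 = (3 : ℝ) := Real.mul_self_sqrt (by norm_num)
  apply Subtype.ext
  change conjMat.1 * rotMat.1 * conjMat.1 = rotMat.1 ^ 2
  rw [pow_two]
  ext i j
  fin_cases i <;> fin_cases j <;> simp [conjMat, rotMat, Matrix.mul_apply] <;>
    first
    | linear_combination (1 / 4) * h
    | ring

theorem conjMat_mem_groupC2 : conjMat ∈ groupC2 := Subgroup.subset_closure rfl

theorem mem_groupC2_iff (F : Matrix.orthogonalGroup (Fin 2) ℝ) :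
    F ∈ groupC2 ↔ F = 1 ∨ F = conjMat := by
  constructor
  · intro h
    induction h using Subgroup.closure_induction with
    | mem x hx => exact Or.inr hx
    | one => exact Or.inl rfl
    | mul x y _ _ hx hy =>
      rcases hx with rfl | rfl <;> rcases hy with rfl | rfl <;> simp [conjMat_mul_self]
    | inv x _ hx =>
      rcases hx with rfl | rfl
      · simp
      · exact Or.inr (inv_eq_of_mul_eq_one_left conjMat_mul_self)
  · rintro (rfl | rfl)
    · exact one_mem _
    · exact conjMat_mem_groupC2

theorem finite_groupC2 : Finite groupC2 ∧ Nat.card groupC2 ≤ 2 := by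
  have h : (groupC2 : Set (Matrix.orthogonalGroup (Fin 2) ℝ)) ⊆ {1, conjMat} :=
    fun F hF => (mem_groupC2_iff F).1 hF
  have hfin : ({1, conjMat} : Set (Matrix.orthogonalGroup (Fin 2) ℝ)).Finite := Set.toFinite _
  exact ⟨hfin.subset h, (Set.ncard_le_ncard h hfin).trans (Set.ncard_insert_le _ _ |>.trans (by simp))⟩

theorem rotMat_mem_groupD3 : rotMat ∈ groupD3 := Subgroup.subset_closure (by simp)

theorem conjMat_mem_groupD3 : conjMat ∈ groupD3 := Subgroup.subset_closure (by simp)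

theorem exists_eq_pow_mul_pow_of_mem_groupD3 {F : Matrix.orthogonalGroup (Fin 2) ℝ}
    (hF : F ∈ groupD3) : ∃ k l : ℕ, F = rotMat ^ k * conjMat ^ l := by
  -- Moving `K` past rotations brings every word to the form `R ^ k * K ^ l`.
  have hconj : ∀ k : ℕ, conjMat * rotMat ^ k = rotMat ^ (2 * k) * conjMat := fun k => by
    have h : SemiconjBy conjMat rotMat (rotMat ^ 2) := by
      rw [SemiconjBy, ← conjMat_mul_rotMat, mul_assoc _ conjMat, conjMat_mul_self, mul_one]
    have := h.pow_right k
    rwa [← pow_mul] at this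
  induction hF using Subgroup.closure_induction_left with
  | one => exact ⟨0, 0, by simp⟩
  | mul_left x hx y _ hy =>
    obtain ⟨k, l, rfl⟩ := hy
    rcases hx with rfl | rfl
    · exact ⟨k + 1, l, by rw [pow_succ', mul_assoc]⟩
    · exact ⟨2 * k, l + 1, by rw [← mul_assoc, hconj, pow_succ', mul_assoc]⟩
  | inv_mul_cancel x hx y _ hy =>
    obtain ⟨k, l, rfl⟩ := hy
    rcases hx with rfl | rfl
    · refine ⟨k + 2, l, ?_⟩
      have : rotMat⁻¹ = rotMat ^ 2 :=
        inv_eq_of_mul_eq_one_left (by rw [← pow_succ, rotMat_pow_three])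
      rw [this, ← mul_assoc, ← pow_add, add_comm]
    · rw [inv_eq_of_mul_eq_one_left conjMat_mul_self]
      exact ⟨2 * k, l + 1, by rw [← mul_assoc, hconj, pow_succ', mul_assoc]⟩

theorem natCard_groupD3 : Nat.card groupD3 = 6 := by
  have hR : orderOf rotMat = 3 := by
    have : Fact (Nat.Prime 3) := ⟨Nat.prime_three⟩
    refine orderOf_eq_prime rotMat_pow_three fun h => ?_
    have := congrFun (congrFun (congrArg Subtype.val h) 0) 0
    norm_num [rotMat] at this
  have hK : orderOf conjMat = 2 := by
    have : Fact (Nat.Prime 2) := ⟨Nat.prime_two⟩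
    refine orderOf_eq_prime (by rw [pow_two, conjMat_mul_self]) fun h => ?_
    have := congrFun (congrFun (congrArg Subtype.val h) 1) 1
    norm_num [conjMat] at this
  let w : Fin 3 × Fin 2 → groupD3 := fun x =>
    ⟨rotMat ^ (x.1 : ℕ) * conjMat ^ (x.2 : ℕ),
      mul_mem (pow_mem rotMat_mem_groupD3 _) (pow_mem conjMat_mem_groupD3 _)⟩
  have hw : Function.Surjective w := fun ⟨F, hF⟩ => by
    obtain ⟨k, l, rfl⟩ := exists_eq_pow_mul_pow_of_mem_groupD3 hF
    refine ⟨(⟨k % 3, Nat.mod_lt _ (by norm_num)⟩, ⟨l % 2, Nat.mod_lt _ (by norm_num)⟩),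
      Subtype.ext ?_⟩
    change rotMat ^ (k % 3) * conjMat ^ (l % 2) = rotMat ^ k * conjMat ^ l
    rw [← pow_mod_orderOf rotMat k, ← pow_mod_orderOf conjMat l, hR, hK]
  have hfin : Finite groupD3 := Finite.of_surjective w hw
  have hle : Nat.card groupD3 ≤ 6 := by simpa using Nat.card_le_card_of_surjective w hw
  -- The order is at most 6 and divisible by 2 and 3.
  have h3 := groupD3.orderOf_dvd_natCard rotMat_mem_groupD3
  have h2 := groupD3.orderOf_dvd_natCard conjMat_mem_groupD3
  rw [hR] at h3
  rw [hK] at h2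
  have hpos : 0 < Nat.card groupD3 := Nat.card_pos
  omega

/-! ### Groups that describe a block. -/

/-- The properties of a group of orthogonal matrices that make its action groupoid on pairs of
positive definite matrices describe the two-dimensional real division algebras with sign
pair `(α, β)`. -/
structure IsBlockGroup (α β : ℤˣ) (G : Subgroup (Matrix.orthogonalGroup (Fin 2) ℝ)) : Prop where
  -- The pair `(K F K, F, F)` is an autotopy of `ℂ`, so `K F K` is the morphism of algebras attached
  -- to `F`.
  map_mul : ∀ F ∈ G, ∀ x y, realLin (conjMat * F * conjMat).1 (x * y) =
    realLin F.1 x * realLin F.1 y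
  mul_signMat_left : ∀ F ∈ G, signMat α * (conjMat * F * conjMat) = F * signMat α
  mul_signMat_right : ∀ F ∈ G, signMat β * (conjMat * F * conjMat) = F * signMat β
  -- The conditions on `m` and `n` are those produced by `exists_eq_of_isotopy`; this field yields
  -- fullness.
  exists_mem : ∀ m n : ℂ, ∀ σ : ℤˣ, Complex.normSq m = 1 → Complex.normSq n = 1 →
    signConj β (m * n) = m → signConj α (m * n) = n →
      n = m ∧ ∃ F ∈ G, ∀ z, realLin F.1 z = m * signConj σ z

theorem realLin_mul_apply (F F' : Matrix.orthogonalGroup (Fin 2) ℝ) (z : ℂ) :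
    realLin (F * F').1 z = realLin F.1 (realLin F'.1 z) := by
  change realLin (F.1 * F'.1) z = _
  rw [map_mul]
  rfl

theorem realLin_inv_apply (F : Matrix.orthogonalGroup (Fin 2) ℝ) (z : ℂ) :
    realLin F.1 (realLin (F⁻¹).1 z) = z := by
  rw [← realLin_mul_apply, mul_inv_cancel]
  simp

theorem realLin_conjMat_mul_mul (F : Matrix.orthogonalGroup (Fin 2) ℝ) (z : ℂ) :
    realLin (conjMat * F * conjMat).1 z = conj (realLin F.1 (conj z)) := by
  rw [realLin_mul_apply, realLin_mul_apply, realLin_conjMat, realLin_conjMat]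

/-- The property is stable under products and inverses. For the rotation it says `ω̄ = ω²`; for `K`
it is multiplicativity of conjugation. -/
theorem map_mul_of_mem_groupD3 {F : Matrix.orthogonalGroup (Fin 2) ℝ} (hF : F ∈ groupD3) :
    ∀ x y, realLin (conjMat * F * conjMat).1 (x * y) = realLin F.1 x * realLin F.1 y := by
  simp only [realLin_conjMat_mul_mul]
  induction hF using Subgroup.closure_induction with
  | mem F hF =>
    intro x y
    rcases hF with rfl | rfl
    · have h : √3 * √3 = (3 : ℝ) := Real.mul_self_sqrt (by norm_num)
      have hω : conj (⟨-1 / 2, √3 / 2⟩ : ℂ) = ⟨-1 / 2, √3 / 2⟩ * ⟨-1 / 2, √3 / 2⟩ := by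
        apply Complex.ext <;> simp <;> linarith
      rw [realLin_rotMat, realLin_rotMat, realLin_rotMat, _root_.map_mul, hω, Complex.conj_conj]
      ring
    · simp [realLin_conjMat]
  | one => intro x y; simp
  | mul F F' _ _ h h' =>
    intro x y
    simp only [realLin_mul_apply]
    rw [← h, ← h', Complex.conj_conj]
  | inv F _ h =>
    intro x y
    have := h (realLin (F⁻¹).1 x) (realLin (F⁻¹).1 y)
    rw [realLin_inv_apply, realLin_inv_apply] at this
    rw [← this, Complex.conj_conj, ← realLin_mul_apply, inv_mul_cancel]
    simp

theorem groupC2_le_groupD3 : groupC2 ≤ groupD3 :=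
  (Subgroup.closure_le _).2 (by simpa using conjMat_mem_groupD3)

theorem exists_mem_groupC2 (σ : ℤˣ) : ∃ F ∈ groupC2, ∀ z, realLin F.1 z = signConj σ z := by
  refine ⟨signMat σ, (mem_groupC2_iff _).2 ?_, realLin_signMat σ⟩
  unfold signMat
  split <;> simp

theorem isBlockGroup_groupC2 {α β : ℤˣ} (h : (α, β) ≠ (-1, -1)) :
    IsBlockGroup α β groupC2 := by
  have comm : ∀ (ε : ℤˣ), ∀ F ∈ groupC2,
      signMat ε * (conjMat * F * conjMat) = F * signMat ε := fun ε F hF => by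
    rcases Int.units_eq_one_or ε with rfl | rfl <;>
    rcases (mem_groupC2_iff F).1 hF with rfl | rfl <;> simp [signMat, conjMat_mul_self]
  refine ⟨fun F hF => map_mul_of_mem_groupD3 (groupC2_le_groupD3 hF), comm α, comm β,
    fun m n σ hm hn hβ hα => ?_⟩
  have hm0 : m ≠ 0 := fun h => by simp [h] at hm
  have hn0 : n ≠ 0 := fun h => by simp [h] at hn
  -- A positive sign makes one of the equations `m n = m` or `m n = n`, and the other equation then
  -- settles the remaining unknown.
  obtain ⟨rfl, rfl⟩ : m = 1 ∧ n = 1 := by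
    rcases Int.units_eq_one_or α with rfl | rfl <;> rcases Int.units_eq_one_or β with rfl | rfl
    · simp_all
    · obtain rfl : m = 1 := by simpa [hn0] using hα
      exact ⟨rfl, by simpa using congrArg conj hβ⟩
    · obtain rfl : n = 1 := by simpa [hm0] using hβ
      exact ⟨by simpa using congrArg conj hα, rfl⟩
    · exact absurd rfl h
  simpa using exists_mem_groupC2 σ

theorem exists_mem_groupD3 {m : ℂ} (hm : m ^ 3 = 1) :
    ∃ F ∈ groupD3, ∀ z, realLin F.1 z = m * z := by
  have h : √3 * √3 = (3 : ℝ) := Real.mul_self_sqrt (by norm_num)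
  have hω : (⟨-1 / 2, √3 / 2⟩ * ⟨-1 / 2, √3 / 2⟩ + ⟨-1 / 2, √3 / 2⟩ + 1 : ℂ) = 0 := by
    apply Complex.ext <;> simp <;> linarith
  have hfac : (m - 1) * ((m - ⟨-1 / 2, √3 / 2⟩) * (m - ⟨-1 / 2, √3 / 2⟩ ^ 2)) = 0 := by
    generalize (⟨-1 / 2, √3 / 2⟩ : ℂ) = ω at hω
    linear_combination hm + (m - 1) * (ω - 1 - m) * hω
  rcases mul_eq_zero.1 hfac with h1 | h1
  · exact ⟨1, one_mem _, fun z => by simp [sub_eq_zero.1 h1]⟩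
  rcases mul_eq_zero.1 h1 with h1 | h1
  · exact ⟨rotMat, rotMat_mem_groupD3, fun z => by rw [realLin_rotMat, sub_eq_zero.1 h1]⟩
  · exact ⟨rotMat * rotMat, mul_mem rotMat_mem_groupD3 rotMat_mem_groupD3, fun z => by
      rw [realLin_mul_apply, realLin_rotMat, realLin_rotMat, sub_eq_zero.1 h1]
      ring⟩

theorem isBlockGroup_groupD3 : IsBlockGroup (-1) (-1) groupD3 := by
  have comm : ∀ F ∈ groupD3,
      signMat (-1) * (conjMat * F * conjMat) = F * signMat (-1) := fun F _ => by
    simp [signMat, ← mul_assoc, conjMat_mul_self]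
  refine ⟨fun F hF => map_mul_of_mem_groupD3 hF, comm, comm, fun m n σ hm hn hβ hα => ?_⟩
  obtain rfl : n = m := hα.symm.trans hβ
  refine ⟨rfl, ?_⟩
  -- From `conj (n²) = n` and `|n| = 1`: `n³ = n n̄ = 1`.
  have hn3 : n ^ 3 = 1 := by
    have h1 : n * conj n = 1 := by rw [Complex.mul_conj, hn, Complex.ofReal_one]
    have h2 : n * n = conj n := by
      rw [signConj_neg_one] at hβ
      simpa using congrArg conj hβ
    rw [pow_three, h2, h1]
  obtain ⟨F, hF, hFn⟩ := exists_mem_groupD3 hn3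
  obtain ⟨F', hF', hFσ⟩ := exists_mem_groupC2 σ
  exact ⟨F * F', mul_mem hF (groupC2_le_groupD3 hF'), fun z => by
    rw [realLin_mul_apply, hFn, hFσ]⟩

theorem sign_det_realLin (ε : ℤˣ) (A : SPDS) :
    SignType.sign (LinearMap.det (realLin (A.1 * (signMat ε).1))) = SignType.sign (ε : ℤ) := by
  rw [det_realLin, Matrix.det_mul, A.2.2, one_mul]
  rcases Int.units_eq_one_or ε with rfl | rfl
  · simp [signMat]
  · simp [signMat, conjMat]

theorem bijective_realLin (ε : ℤˣ) (A : SPDS) :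
    Function.Bijective (realLin (A.1 * (signMat ε).1)) :=
  LinearMap.bijective_of_det_ne_zero fun h => by
    have := sign_det_realLin ε A
    rw [h] at this
    rcases Int.units_eq_one_or ε with rfl | rfl <;> simp at this

theorem bijective_realLin_orthogonal (F : Matrix.orthogonalGroup (Fin 2) ℝ) :
    Function.Bijective (realLin F.1) :=
  Function.bijective_iff_has_inverse.2 ⟨realLin (F⁻¹).1,
    fun z => by simpa using realLin_inv_apply F⁻¹ z, realLin_inv_apply F⟩

/-- With `S = signMat ε`, the right side reads `B S F' = F A S`. Since `S F' = F S` and `S` is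
invertible, this is `B F = F A`, that is `F A Fᵗ = B`. -/
theorem smul_eq_iff {ε : ℤˣ} {F F' : Matrix.orthogonalGroup (Fin 2) ℝ} {A B : SPDS}
    (hF : signMat ε * F' = F * signMat ε) :
    F • A = B ↔ ∀ z, realLin (B.1 * (signMat ε).1) (realLin F'.1 z) =
      realLin F.1 (realLin (A.1 * (signMat ε).1) z) := by
  have hFF : F.1 * F.1.transpose = 1 := (Matrix.mem_orthogonalGroup_iff (Fin 2) ℝ).1 F.2
  have hFF' : F.1.transpose * F.1 = 1 := (Matrix.mem_orthogonalGroup_iff' (Fin 2) ℝ).1 F.2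
  have hS : (signMat ε).1 * (signMat ε).1.transpose = 1 :=
    (Matrix.mem_orthogonalGroup_iff (Fin 2) ℝ).1 (signMat ε).2
  have hF1 : (signMat ε).1 * F'.1 = F.1 * (signMat ε).1 := congrArg Subtype.val hF
  have key : (∀ z, realLin (B.1 * (signMat ε).1) (realLin F'.1 z) =
      realLin F.1 (realLin (A.1 * (signMat ε).1) z)) ↔ B.1 * F.1 = F.1 * A.1 := by
    trans B.1 * (signMat ε).1 * F'.1 = F.1 * (A.1 * (signMat ε).1)
    · rw [← realLin.injective.eq_iff, _root_.map_mul realLin (B.1 * _), _root_.map_mul realLin F.1,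
        LinearMap.ext_iff]
      rfl
    · rw [mul_assoc, hF1, ← mul_assoc, ← mul_assoc]
      refine ⟨fun h => ?_, fun h => by rw [h]⟩
      have := congrArg (· * (signMat ε).1.transpose) h
      simpa [mul_assoc, hS] using this
  rw [key, Subtype.ext_iff]
  change F.1 * A.1 * F.1.transpose = B.1 ↔ _
  constructor
  · intro h
    rw [← h, mul_assoc _ _ F.1, hFF', mul_one]
  · intro h
    rw [← h, mul_assoc, hFF, mul_one]

/-! ### The equivalence between the action groupoid and the block. -/

namespace IsBlockGroup

open RealDivAlg

variable {α β : ℤˣ} {G : Subgroup (Matrix.orthogonalGroup (Fin 2) ℝ)}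

/-- The algebra attached to a pair of positive definite matrices. -/
noncomputable def blockObj (α β : ℤˣ) (P : SPDS × SPDS) : Block.{u} 2 α β :=
  ⟨isotope _ _ (bijective_realLin β P.1) (bijective_realLin α P.2),
    hasSignPair_isotope _ _ (sign_det_realLin β P.1) (sign_det_realLin α P.2)⟩

/-- The morphism of algebras given by a matrix of the block group. -/
noncomputable def blockHom (h : IsBlockGroup α β G) (F : G) {P Q : SPDS × SPDS}
    (hPQ : F • P = Q) : blockObj.{u} α β P ⟶ blockObj.{u} α β Q :=
  ObjectProperty.homMk (isotopeHom (bijective_realLin β P.1) (bijective_realLin α P.2)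
    (bijective_realLin β Q.1) (bijective_realLin α Q.2) (realLin (conjMat * F.1 * conjMat).1)
    (bijective_realLin_orthogonal _).1 fun x y => by
      rw [h.map_mul F F.2,
        (smul_eq_iff (h.mul_signMat_right F F.2)).1 (congrArg Prod.fst hPQ),
        (smul_eq_iff (h.mul_signMat_left F F.2)).1 (congrArg Prod.snd hPQ)])

/-- The identification of the algebra attached to a pair of matrices with `ℂ`. -/
noncomputable def blockEquiv (α β : ℤˣ) (P : SPDS × SPDS) : (blockObj.{u} α β P).obj ≃ₗ[ℝ] ℂ :=
  isotopeEquiv (bijective_realLin β P.1) (bijective_realLin α P.2)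

theorem blockEquiv_mul (P : SPDS × SPDS) (x y : (blockObj.{u} α β P).obj) :
    blockEquiv α β P (x * y) = realLin (P.1.1 * (signMat β).1) (blockEquiv α β P x) *
      realLin (P.2.1 * (signMat α).1) (blockEquiv α β P y) :=
  isotopeEquiv_mul (bijective_realLin β P.1) (bijective_realLin α P.2) x y

theorem blockHom_apply (h : IsBlockGroup α β G) (F : G) {P Q : SPDS × SPDS}
    (hPQ : F • P = Q) (x : (blockObj.{u} α β P).obj) :
    (h.blockHom F hPQ).hom.toAlgHom x = (blockEquiv α β Q).symm
      (realLin (conjMat * F.1 * conjMat).1 (blockEquiv α β P x)) := rfl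

theorem blockHom_one (h : IsBlockGroup α β G) (P : SPDS × SPDS) :
    h.blockHom.{u} 1 (one_smul G P) = 𝟙 (blockObj α β P) := by
  refine ObjectProperty.hom_ext _ (Hom.ext (NonUnitalAlgHom.ext fun x => ?_))
  rw [h.blockHom_apply, OneMemClass.coe_one, mul_one, conjMat_mul_self, OneMemClass.coe_one,
    map_one, Module.End.one_apply, LinearEquiv.symm_apply_apply]
  rfl

theorem blockHom_mul (h : IsBlockGroup α β G) (F F' : G) {P Q R : SPDS × SPDS}
    (hPQ : F • P = Q) (hQR : F' • Q = R) (hPR : (F' * F) • P = R) :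
    h.blockHom.{u} (F' * F) hPR = h.blockHom F hPQ ≫ h.blockHom F' hQR := by
  refine ObjectProperty.hom_ext _ (Hom.ext (NonUnitalAlgHom.ext fun x => ?_))
  have hx : conjMat * (F'.1 * F.1) * conjMat =
      (conjMat * F'.1 * conjMat) * (conjMat * F.1 * conjMat) := by
    rw [mul_assoc _ conjMat, ← mul_assoc conjMat (conjMat * F.1), ← mul_assoc conjMat conjMat,
      conjMat_mul_self, one_mul]
    simp only [mul_assoc]
  refine .trans ?_ (h.blockHom_apply F' hQR ((h.blockHom F hPQ).hom.toAlgHom x)).symm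
  rw [h.blockHom_apply, h.blockHom_apply, Subgroup.coe_mul, hx, realLin_mul_apply,
    LinearEquiv.apply_symm_apply]

/-- The functor from the action groupoid to the block of real division algebras. -/
noncomputable def toBlock (h : IsBlockGroup α β G) :
    ActionCategory G (SPDS × SPDS) ⥤ Block.{u} 2 α β where
  obj X := blockObj α β X.back
  map F := h.blockHom F.1 F.2
  map_id X := h.blockHom_one X.back
  map_comp F F' := h.blockHom_mul F.1 F'.1 F.2 F'.2 (F ≫ F').2

theorem realLin_injective_orthogonal {F F' : Matrix.orthogonalGroup (Fin 2) ℝ}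
    (h : ∀ z, realLin F.1 z = realLin F'.1 z) : F = F' :=
  Subtype.ext (realLin.injective (LinearMap.ext h))

theorem blockHom_injective (h : IsBlockGroup α β G) {F F' : G} {P Q : SPDS × SPDS}
    (hF : F • P = Q) (hF' : F' • P = Q) (hFF : h.blockHom.{u} F hF = h.blockHom F' hF') :
    F = F' := by
  have key : conjMat * F.1 * conjMat = conjMat * F'.1 * conjMat := by
    refine realLin_injective_orthogonal fun z => ?_
    have := congrArg (fun k => k.hom.toAlgHom ((blockEquiv α β P).symm z)) hFF
    simp only [blockHom_apply, LinearEquiv.apply_symm_apply] at this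
    exact LinearEquiv.injective _ this
  exact Subtype.ext (mul_left_cancel (mul_right_cancel key))

theorem faithful_toBlock (h : IsBlockGroup α β G) : h.toBlock.{u}.Faithful where
  map_injective {_ _ F F'} hFF := Subtype.ext (h.blockHom_injective F.2 F'.2 hFF)

theorem full_toBlock (h : IsBlockGroup α β G) : h.toBlock.{u}.Full where
  map_surjective {X Y} k := by
    obtain ⟨φ, hφ, hmul, hk⟩ := exists_eq_isotopeHom (bijective_realLin β X.back.1)
      (bijective_realLin α X.back.2) (bijective_realLin β Y.back.1)
      (bijective_realLin α Y.back.2) k.hom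
    obtain ⟨m, n, σ, hm, hn, hβ, hα, h0, h1, h2⟩ := exists_eq_of_isotopy
      (isNormalForm_realLin β X.back.1) (isNormalForm_realLin α X.back.2)
      (isNormalForm_realLin β Y.back.1) (isNormalForm_realLin α Y.back.2)
      (bijective_realLin β X.back.1) (bijective_realLin α X.back.2) hφ hmul
    obtain ⟨rfl, F, hF, hFz⟩ := h.exists_mem m n σ hm hn hβ hα
    -- Taking `x = 1` in `map_mul` gives `K F K z = F 1 * F z = m² σ(z)`, which is `φ z` because `n
    -- = m`.
    have hφF : φ = realLin (conjMat * F * conjMat).1 := LinearMap.ext fun z => by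
      have := h.map_mul F hF 1 z
      rw [one_mul, hFz, hFz, map_one, mul_one] at this
      rw [h0, this, mul_assoc]
    subst hφF
    have hXY : (⟨F, hF⟩ : G) • X.back = Y.back := Prod.ext
      ((smul_eq_iff (h.mul_signMat_right F hF)).2 fun z => by rw [h1, hFz])
      ((smul_eq_iff (h.mul_signMat_left F hF)).2 fun z => by rw [h2, hFz])
    exact ⟨⟨⟨F, hF⟩, hXY⟩, ObjectProperty.hom_ext _ hk.symm⟩

theorem exists_iso_blockObj (X : Block.{u} 2 α β) :
    ∃ P, Nonempty (blockObj.{u} α β P ≅ X) := by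
  obtain ⟨u, e, hu, he⟩ := exists_isotopy X.obj X.property.1
  obtain ⟨hL, hR⟩ := X.property.2 u hu
  let f : ℂ →ₗ[ℝ] ℂ := e.symm.toLinearMap ∘ₗ LinearMap.mulRight ℝ u ∘ₗ e.symm.symm.toLinearMap
  let g : ℂ →ₗ[ℝ] ℂ := e.symm.toLinearMap ∘ₗ LinearMap.mulLeft ℝ u ∘ₗ e.symm.symm.toLinearMap
  obtain ⟨a, b, ha, hb, hf, hg⟩ := exists_isNormalForm_pair (α := α) (β := β) (f := f) (g := g)
    (by rwa [LinearMap.det_conj]) (by rwa [LinearMap.det_conj])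
  have hc : (a * b)⁻¹ ≠ 0 := inv_ne_zero (mul_ne_zero ha hb)
  obtain ⟨P, hP⟩ := IsNormalForm.exists_SPDS
    (f := LinearMap.mulLeft ℝ a ∘ₗ f ∘ₗ LinearMap.mulLeft ℝ (a * b)⁻¹) hf
  obtain ⟨Q, hQ⟩ := IsNormalForm.exists_SPDS
    (f := LinearMap.mulLeft ℝ b ∘ₗ g ∘ₗ LinearMap.mulLeft ℝ (a * b)⁻¹) hg
  -- Scaling by `(ab)⁻¹` carries the product `a f(c x) * b g(c y)` to `f(c x) * g(c y)`.
  let c : ℂ ≃ₗ[ℝ] ℂ := LinearEquiv.ofBijective (LinearMap.mulLeft ℝ (a * b)⁻¹)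
    (mulLeft_bijective₀ _ hc)
  have hcz : ∀ z, c z = (a * b)⁻¹ * z := fun z => rfl
  refine ⟨(P, Q), ⟨ObjectProperty.isoMk _ (isoOfLinearEquiv
    ((blockEquiv α β (P, Q)).trans (c.trans e))
    fun x y => ?_)⟩⟩
  rw [LinearEquiv.trans_apply, LinearEquiv.trans_apply, LinearEquiv.trans_apply,
    LinearEquiv.trans_apply, LinearEquiv.trans_apply, LinearEquiv.trans_apply, he, blockEquiv_mul,
    ← hP, ← hQ]
  change e ((a * b)⁻¹ * ((a * f (c _)) * (b * g (c _)))) = e (f (c _) * g (c _))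
  congr 1
  field_simp

theorem essSurj_toBlock (h : IsBlockGroup α β G) : h.toBlock.{u}.EssSurj where
  mem_essImage X := by
    obtain ⟨P, hP⟩ := exists_iso_blockObj X
    exact ⟨(P : ActionCategory G (SPDS × SPDS)), hP⟩

/-- The action groupoid is equivalent to the block of real division algebras. -/
noncomputable def blockEquivalence (h : IsBlockGroup α β G) :
    ActionCategory G (SPDS × SPDS) ≌ Block.{u} 2 α β :=
  have := h.faithful_toBlock.{u}
  have := h.full_toBlock.{u}
  have := h.essSurj_toBlock.{u}
  have : h.toBlock.{u}.IsEquivalence := {}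
  h.toBlock.asEquivalence

end IsBlockGroup

/-! ### Automorphism groups and the comparison of blocks. -/

open RealDivAlg

/-- An equivalence of categories preserves automorphism groups. -/
noncomputable def CategoryTheory.Equivalence.autEquiv {C D : Type*} [Category* C] [Category* D]
    (E : C ≌ D) (X : C) : Aut X ≃* Aut (E.functor.obj X) :=
  E.fullyFaithfulFunctor.autMulEquivOfFullyFaithful X

/-- Automorphisms in an action groupoid are the elements of the stabilizer. -/
def CategoryTheory.ActionCategory.autEquivStabilizer {G S : Type*} [Group G] [MulAction G S]
    (X : ActionCategory G S) : Aut X ≃ MulAction.stabilizer G X.back :=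
  (Groupoid.isoEquivHom X X).trans
    { toFun := fun F => ⟨F.1, F.2⟩
      invFun := fun F => ⟨F.1, F.2⟩
      left_inv := fun _ => rfl
      right_inv := fun _ => rfl }

theorem card_aut_le_two {α β : ℤˣ} (h : (α, β) ≠ (-1, -1)) (X : Block.{u} 2 α β) :
    Finite (Aut X) ∧ Nat.card (Aut X) ≤ 2 := by
  let E := (isBlockGroup_groupC2 h).blockEquivalence.{u}
  let e := (E.symm.autEquiv X).toEquiv.trans
    (ActionCategory.autEquivStabilizer (E.symm.functor.obj X))
  obtain ⟨hfin, hcard⟩ := finite_groupC2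
  exact ⟨Finite.of_equiv _ e.symm, (Nat.card_congr e).trans_le
    ((Subgroup.card_le_card_group _).trans hcard)⟩

theorem exists_card_aut_eq_six : ∃ X : Block.{u} 2 (-1) (-1), Nat.card (Aut X) = 6 := by
  let E := isBlockGroup_groupD3.blockEquivalence.{u}
  -- The identity matrix is fixed by all orthogonal matrices, so the stabilizer of `(I, I)` is the
  -- whole group.
  let I : SPDS := ⟨1, Matrix.PosDef.one, Matrix.det_one⟩
  let X : ActionCategory groupD3 (SPDS × SPDS) := ((I, I) : SPDS × SPDS)
  refine ⟨E.functor.obj X, ?_⟩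
  rw [← Nat.card_congr (E.autEquiv X).toEquiv,
    Nat.card_congr (ActionCategory.autEquivStabilizer X)]
  have hI : ∀ F : Matrix.orthogonalGroup (Fin 2) ℝ, F • I = I := fun F => Subtype.ext (by
    change F.1 * 1 * F.1.transpose = 1
    rw [mul_one]
    exact (Matrix.mem_orthogonalGroup_iff (Fin 2) ℝ).1 F.2)
  have htop : MulAction.stabilizer groupD3 X.back = ⊤ :=
    eq_top_iff.2 fun F _ => Prod.ext (hI F.1) (hI F.1)
  rw [htop, Subgroup.card_top, natCard_groupD3]

theorem not_equivalent_block {α β : ℤˣ} (h : (α, β) ≠ (-1, -1)) :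
    ¬ Nonempty (Block.{u} 2 α β ≌ Block.{u} 2 (-1) (-1)) := by
  rintro ⟨E⟩
  obtain ⟨X, hX⟩ := exists_card_aut_eq_six.{u}
  have := (card_aut_le_two h (E.symm.functor.obj X)).2
  rw [← Nat.card_congr (E.symm.autEquiv X).toEquiv, hX] at this
  omega

theorem mainTheorem6 :
    -- the three blocks are equivalent to each other
    (Nonempty (RealDivAlg.Block.{u} 2 1 1 ≌ RealDivAlg.Block.{u} 2 1 (-1)) ∧
      Nonempty (RealDivAlg.Block.{u} 2 1 1 ≌ RealDivAlg.Block.{u} 2 (-1) 1) ∧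
      Nonempty (RealDivAlg.Block.{u} 2 1 (-1) ≌ RealDivAlg.Block.{u} 2 (-1) 1)) ∧
    -- none of them is equivalent to the fourth
    (¬ Nonempty (RealDivAlg.Block.{u} 2 1 1 ≌ RealDivAlg.Block.{u} 2 (-1) (-1)) ∧
      ¬ Nonempty (RealDivAlg.Block.{u} 2 1 (-1) ≌ RealDivAlg.Block.{u} 2 (-1) (-1)) ∧
      ¬ Nonempty (RealDivAlg.Block.{u} 2 (-1) 1 ≌ RealDivAlg.Block.{u} 2 (-1) (-1))) ∧
    -- description by action groupoids
    (Nonempty (ActionCategory groupC2 (SPDS × SPDS) ≌ RealDivAlg.Block.{u} 2 1 1) ∧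
      Nonempty (ActionCategory groupC2 (SPDS × SPDS) ≌ RealDivAlg.Block.{u} 2 1 (-1)) ∧
      Nonempty (ActionCategory groupC2 (SPDS × SPDS) ≌ RealDivAlg.Block.{u} 2 (-1) 1) ∧
      Nonempty (ActionCategory groupD3 (SPDS × SPDS) ≌ RealDivAlg.Block.{u} 2 (-1) (-1))) ∧
    -- automorphism groups
    (∃ X : RealDivAlg.Block.{u} 2 (-1) (-1), Nat.card (Aut X) = 6) ∧
    (∀ α β : ℤˣ, (α, β) ≠ (-1, -1) → ∀ X : RealDivAlg.Block.{u} 2 α β,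
      Finite (Aut X) ∧ Nat.card (Aut X) ≤ 2) := by
  have hpp : ((1 : ℤˣ), (1 : ℤˣ)) ≠ (-1, -1) := by decide
  have hpm : ((1 : ℤˣ), (-1 : ℤˣ)) ≠ (-1, -1) := by decide
  have hmp : ((-1 : ℤˣ), (1 : ℤˣ)) ≠ (-1, -1) := by decide
  let Epp := (isBlockGroup_groupC2 hpp).blockEquivalence.{u}
  let Epm := (isBlockGroup_groupC2 hpm).blockEquivalence.{u}
  let Emp := (isBlockGroup_groupC2 hmp).blockEquivalence.{u}
  exact ⟨⟨⟨Epp.symm.trans Epm⟩, ⟨Epp.symm.trans Emp⟩, ⟨Epm.symm.trans Emp⟩⟩,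
    ⟨not_equivalent_block hpp, not_equivalent_block hpm, not_equivalent_block hmp⟩,
    ⟨⟨Epp⟩, ⟨Epm⟩, ⟨Emp⟩, ⟨isBlockGroup_groupD3.blockEquivalence⟩⟩,
    exists_card_aut_eq_six, fun _ _ h X => card_aut_le_two h X⟩
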